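/- **Setting.** Let $\mathbf{CLK}$ be the category whose objects (worlds) are pairs $U=(n,\partial_U)$ with $n\ge 1$ (the clock names are $\{0,\dots,n-1\}$) and $\partial_U:\{0,\dots,n-1\}\to\mathbb N$ (time left on each clock), and whose morphisms $\rho:V\to U$ are functions $\rho^*$ from the clock names of $U$ to those of $V$ with $\partial_V(\rho^*\kappa)\le\partial_U(\kappa)$ for all $\kappa$. The *topos of clocks* is the category of presheaves of sets on $\mathbf{CLK}$; $\mathrm{Clk}$ is its object of clock names, $U\mapsto\{0,\dots,n-1\}$, and $U\Vdash\varphi$ is Kripke–Joyal forcing. The modality $\triangleright_\kappa\varphi$ is forced at $U$ iff $\partial_U(\kappa)=0$, or $\partial_U(\kappa)=m+1$ and $\varphi$ (restricted) is forced at $U[\kappa\mapsto m]$. **Programs.** All of the following is carried out inside the topos. $\mathrm{Tm}_n$ ($n$ free variables) is the inductively defined family of objects generated by: variables, $\lambda M$, $M(N)$, clock abstraction $\lambda F$ with $F\in\mathrm{Tm}_n^{\mathrm{Clk}}$, clock application $M(\kappa)$, pairs and projections, $\mathsf{fix}\,x.M$, $\star$, $\mathsf{tt}$, $\mathsf{ff}$,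 $\mathsf{if}$, $\mathsf{ze}$, $\mathsf{su}$, $\mathsf{ifze}$, $\mathsf{sup}(M;x.N)$, $\mathsf{wrec}(M;x.y.z.N)$, and the type formers $\Pi$, $\Sigma$, $W$, equality, $\triangleright_\kappa A$, clock product $\prod F$ and clock intersection $\bigcap F$ with $F\in\mathrm{Tm}_n^{\mathrm{Clk}}$, $\mathsf{void}$, $\mathsf{unit}$, $\mathsf{bool}$, $\mathsf{nat}$, $\mathsf{U}_i$. Closed programs carry the usual weak-head small-step semantics: abstractions, pairs, constants, $\mathsf{su}$, $\mathsf{sup}$ and type formers are values; the principal argument of an eliminator is evaluated; $\mathsf{fix}\,x.M\mapsto M[\mathsf{fix}\,x.M/x]$; $(\lambda F)(\kappa)\mapsto F(\kappa)$; $\mathsf{wrec}(\mathsf{sup}(M;u.N);x.y.z.O)\mapsto O[M/x,\ \lambda u.N/y,\ \lambda u.\mathsf{wrec}(N;x.y.z.O)/z]$. Write $M\Downarrow V$ for evaluation to a value. Closed $M_0,M_1$ are *Kleene equivalent* if for every value $V$, $M_0\mapsto^*V$ iff $M_1\mapsto^*V$; open programs are Kleene equivalent if all their closing instances are. **Type systems.**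 A candidate type system is a relation $\tau$ between closed programs and binary relations on closed programs. For a candidate type system $\sigma$, $\mathrm{Clo}(\sigma)$ is the least $\tau$ containing $\sigma$ and all $(A,\mathcal X)$ such that $A$ evaluates to a canonical type $A'$ with $(A',\mathcal X)$ given from $\tau$ by the Nuprl-style clause for its connective: $\mathsf{bool}$ has $\mathcal X=\{(M_0,M_1)\mid \text{both evaluate to }\mathsf{tt}\text{ or both to }\mathsf{ff}\}$; $\triangleright_\kappa A$ is a type with $\mathcal X=\{(M_0,M_1)\mid\triangleright_\kappa((M_0,M_1)\in\mathcal A)\}$ if $\triangleright_\kappa((A,\mathcal A)\in\tau)$; $\bigcap F$ and $\prod F$ are types with $\mathcal X=\{(M_0,M_1)\mid\forall\kappa.\,(M_0,M_1)\in\mathcal A(\kappa)\}$, resp. $\{(M_0,M_1)\mid\forall\kappa.\,(M_0(\kappa),M_1(\kappa))\in\mathcal A(\kappa)\}$, if $\forall\kappa.\,(F(\kappa),\mathcal A(\kappa))\in\tau$; and $\mathsf{void},\mathsf{unit},\mathsf{nat},\Sigma,\Pi,W$ and equality types have the standard extensional clauses (functional families; $\Sigma$ and $\Pi$ through projections and application;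 $\mathsf{nat}$ and $W$ by least fixed points). Put $\nu_0=\emptyset$, let $\nu_{n+1}$ consist of the $(A,\mathcal U)$ with $A\Downarrow\mathsf U_i$, $i\le n$, and $\mathcal U=\{(A_0,A_1)\mid\exists\mathcal A.\,(A_0,\mathcal A),(A_1,\mathcal A)\in\mathrm{Clo}(\nu_i)\}$, and let $\tau_\omega=\bigcup_n\mathrm{Clo}(\nu_n)$. **Judgments.** Formal terms are the corresponding ordinary first-order syntax, with clock variables bound by $\lambda k$, $\prod_k$, $\bigcap_k$; a formal term $M$ with $d$ clock variables and $n$ variables elaborates compositionally to $[\![M]\!]:\mathrm{Clk}^d\to\mathrm{Tm}_n$, a clock binder being sent to $\kappa\mapsto[\![M]\!](\varrho,\kappa)$. The judgment $\Delta\mid\Gamma\vdash M_0=M_1\in A$ means: for all $\varrho\in\mathrm{Clk}^\Delta$, if $[\![\Gamma]\!]\varrho$ is a valid context in $\tau_\omega$ and $[\![A]\!]\varrho$ is functionally a type over it, then $\tau_\omega$-similar instantiations $\gamma_0,\gamma_1$ of $[\![\Gamma]\!]\varrho$ give elements $[\![M_0]\!]\varrho[\gamma_0]$, $[\![M_1]\!]\varrho[\gamma_1]$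 related in $[\![A]\!]\varrho[\gamma_0]$. The judgment $\Delta\mid\Psi\vdash M_0\simeq M_1$ means that $[\![M_0]\!]\varrho$ and $[\![M_1]\!]\varrho$ are Kleene equivalent for all $\varrho\in\mathrm{Clk}^\Delta$. Both are propositions of the internal logic. Let $\mathbf 2$ be the (constant) boolean object, with $\lfloor\cdot\rfloor$ sending its two elements to the formal terms $\mathsf{tt}$ and $\mathsf{ff}$. **Theorem (Canonicity).** Let $M$ be a closed formal term (no free variables, no free clock variables). Then the topos of clocks validates $$(\cdot\mid\cdot\vdash M=M\in\mathsf{bool})\ \Rightarrow\ \exists b\in\mathbf 2.\ (\cdot\mid\cdot\vdash M\simeq\lfloor b\rfloor),$$ that is, at every world $U$ at which $\cdot\mid\cdot\vdash M=M\in\mathsf{bool}$ is forced there is $b\in\mathbf 2$ such that $\cdot\mid\cdot\vdash M\simeq\lfloor b\rfloor$ is forced at $U$. In particular, if $\cdot\mid\cdot\vdash M=M\in\mathsf{bool}$ holds in the topos (at all worlds), then there is a single boolean $b$ such that $\cdot\mid\cdot\vdash M\simeq\lfloor b\rfloor$ holds in the topos. -/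

import Mathlib

namespace GCTT

open CategoryTheory Opposite

/-! ## The category of clock worlds and its presheaf topos -/

/-- A world: a non-empty finite set of clock names together with the time left on each clock. -/
structure World where
  card : ℕ
  card_pos : 0 < card
  time : Fin card → ℕ

/-- A morphism `V ⟶ U` of worlds: a map `•^V ⟶ •^U` of the free category with non-empty finite
products on one object, i.e. a function from the clock names of `U` to those of `V`, such that
the reindexed times of `V` are pointwise at most the times of `U`. -/
@[ext] structure World.Hom (V U : World) where
  fn : Fin U.card → Fin V.card
  le : ∀ k, V.time (fn k) ≤ U.time k

instance : Category World where
  Hom := World.Hom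
  id U := ⟨fun k => k, fun _ => le_rfl⟩
  comp f g := ⟨fun k => f.fn (g.fn k), fun k => (f.le (g.fn k)).trans (g.le k)⟩

/-- The action `ρ^* κ` of a morphism of worlds on clock names. -/
def act {U V : World} (ρ : V ⟶ U) (κ : Fin U.card) : Fin V.card := World.Hom.fn ρ κ

@[simp] theorem act_id {U : World} (κ : Fin U.card) : act (𝟙 U) κ = κ := rfl

@[simp] theorem act_comp {U V W : World} (σ : W ⟶ V) (ρ : V ⟶ U) (κ : Fin U.card) :
    act (σ ≫ ρ) κ = act σ (act ρ κ) := rfl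

theorem act_le {U V : World} (ρ : V ⟶ U) (κ : Fin U.card) :
    V.time (act ρ κ) ≤ U.time κ := World.Hom.le ρ κ

theorem hom_ext {U V : World} {ρ σ : V ⟶ U} (h : ∀ κ, act ρ κ = act σ κ) : ρ = σ :=
  World.Hom.ext (funext h)

/-- The topos of clocks: presheaves on the category of worlds. -/
abbrev ClkTopos := Worldᵒᵖ ⥤ Type

/-- The object of clock names. -/
abbrev clkObj : ClkTopos where
  obj U := Fin U.unop.card
  map f := TypeCat.ofHom (act f.unop)

/-- The binary product of objects of the topos. -/
abbrev prodObj (X Y : ClkTopos) : ClkTopos where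
  obj U := X.obj U × Y.obj U
  map f := TypeCat.ofHom fun p => (X.map f p.1, Y.map f p.2)

/-- Elements at world `U` of the power object of `X`: subobjects of `y(U) × X`. -/
@[ext] structure Pow (X : ClkTopos) (U : World) where
  mem : ∀ {V : World}, (V ⟶ U) → X.obj (op V) → Prop
  closed : ∀ {V W : World} (ρ : V ⟶ U) (σ : W ⟶ V) (x : X.obj (op V)),
    mem ρ x → mem (σ ≫ ρ) (X.map σ.op x)

namespace Pow
variable {X : ClkTopos} {U V W : World}

/-- Restriction of an element of the power object along a morphism of worlds. -/
def res (S : Pow X U) (ρ : V ⟶ U) : Pow X V where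
  mem σ x := S.mem (σ ≫ ρ) x
  closed σ τ x h := by simpa using S.closed (σ ≫ ρ) τ x h

@[simp] theorem res_mem (S : Pow X U) (ρ : V ⟶ U) (σ : W ⟶ V) (x : X.obj (op W)) :
    (S.res ρ).mem σ x ↔ S.mem (σ ≫ ρ) x := Iff.rfl

@[simp] theorem res_id (S : Pow X U) : S.res (𝟙 U) = S := by
  ext V σ x; simp

@[simp] theorem res_res (S : Pow X U) (ρ : V ⟶ U) (σ : W ⟶ V) :
    (S.res ρ).res σ = S.res (σ ≫ ρ) := by
  ext V τ x; simp

/-- The relation `S ⊆ T`, forced at world `U`. -/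
def Sub (S T : Pow X U) : Prop :=
  ∀ (V : World) (ρ : V ⟶ U) (x : X.obj (op V)), S.mem ρ x → T.mem ρ x

/-- The least fixed point of an endomorphism `Φ` of the power object, as given by the
Knaster-Tarski theorem in the internal logic: the intersection of all prefixed points. -/
def lfp (Φ : ∀ {V : World}, (V ⟶ U) → Pow X V → Pow X V) : Pow X U where
  mem {V} ρ x := ∀ (W : World) (σ : W ⟶ V) (S : Pow X W),
    Sub (Φ (σ ≫ ρ) S) S → S.mem (𝟙 W) (X.map σ.op x)
  closed {V W} ρ σ x h W' σ' S hS := by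
    have := h W' (σ' ≫ σ) S (by simpa using hS)
    simpa using this

end Pow

/-- The power object of `X`. -/
abbrev powObj (X : ClkTopos) : ClkTopos where
  obj U := Pow X U.unop
  map f := TypeCat.ofHom fun S => S.res f.unop
  map_id U := by ext S; simp
  map_comp f g := by ext S; simp

/-- Elements at world `U` of the exponential `X ^ Y`. -/
@[ext] structure Exp (Y X : ClkTopos) (U : World) where
  app : ∀ {V : World}, (V ⟶ U) → Y.obj (op V) → X.obj (op V)
  natural : ∀ {V W : World} (ρ : V ⟶ U) (σ : W ⟶ V) (y : Y.obj (op V)),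
    X.map σ.op (app ρ y) = app (σ ≫ ρ) (Y.map σ.op y)

/-- Restriction of an element of the exponential along a morphism of worlds. -/
def Exp.res {Y X : ClkTopos} {U V : World} (F : Exp Y X U) (ρ : V ⟶ U) : Exp Y X V where
  app σ y := F.app (σ ≫ ρ) y
  natural σ τ y := by simpa using F.natural (σ ≫ ρ) τ y

/-! ## The later modality -/

/-- The world `U[κ ↦ n]`. -/
def World.set (U : World) (κ : Fin U.card) (n : ℕ) : World where
  card := U.card
  card_pos := U.card_pos
  time := Function.update U.time κ n

/-- The map `[κ += 1] : U[κ ↦ n] ⟶ U` when the time of `κ` in `U` is `n + 1`. -/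
def tick (U : World) (κ : Fin U.card) (n : ℕ) (h : U.time κ = n + 1) : U.set κ n ⟶ U :=
  World.Hom.mk (fun k => k) (fun k => by
    by_cases hk : k = κ
    · subst hk; simp [World.set, h]
    · simp [World.set, hk])

/-- The forcing clause of the later modality `▷_κ φ` at world `U`, for a proposition `φ` given by
its truth value at every world over `U`: it holds if the time of `κ` is `0`, and if that time is
`n + 1` then `φ` has to hold at `U[κ ↦ n]`. -/
def Later (U : World) (κ : Fin U.card) (φ : ∀ {V : World}, (V ⟶ U) → Prop) : Prop :=
  ∀ (n : ℕ) (h : U.time κ = n + 1), φ (tick U κ n h)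

theorem Later.mono {U V : World} {κ : Fin U.card} {φ : ∀ {V : World}, (V ⟶ U) → Prop}
    (hφ : ∀ {V W : World} (ρ : V ⟶ U) (σ : W ⟶ V), φ ρ → φ (σ ≫ ρ)) (ρ : V ⟶ U)
    (h : Later U κ φ) : Later V (act ρ κ) (fun σ => φ (σ ≫ ρ)) := by
  intro m hm
  obtain ⟨n, hn⟩ : ∃ n, U.time κ = n + 1 :=
    ⟨U.time κ - 1, by have := act_le ρ κ; omega⟩
  have hmn : m ≤ n := by have := act_le ρ κ; omega
  have hle : ∀ k : Fin U.card, (V.set (act ρ κ) m).time (act (U := U) (V := V) ρ k) ≤ (U.set κ n).time k := by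
    intro k
    by_cases hk : k = κ
    · subst hk; simpa [World.set] using hmn
    · have h1 := act_le ρ k
      by_cases h2 : act ρ k = act ρ κ
      · rw [h2, hm] at h1
        simp only [World.set, h2, Function.update_self, Function.update_of_ne hk]
        omega
      · simpa [World.set, hk, h2] using h1
  let ρ' : V.set (act ρ κ) m ⟶ U.set κ n := World.Hom.mk (act (U := U) (V := V) ρ) hle
  have e : tick V (act ρ κ) m hm ≫ ρ = ρ' ≫ tick U κ n hn := World.Hom.ext rfl
  show φ (tick V (act ρ κ) m hm ≫ ρ)
  rw [e]
  exact hφ _ _ (h n hn)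

/-! ## Programs -/

/-- Raw program trees at world `U` with `n` free (de Bruijn) variables. The binders of clocks take
a family of subtrees indexed by the elements of `y(U) × Clk`; see `Raw.Natural`. -/
inductive Raw : World → ℕ → Type
  | var {U : World} {n : ℕ} (i : Fin n) : Raw U n
  | lam {U : World} {n : ℕ} (M : Raw U (n + 1)) : Raw U n
  | klam {U : World} {n : ℕ} (M : (V : World) → (V ⟶ U) → Fin V.card → Raw V n) : Raw U n
  | app {U : World} {n : ℕ} (M N : Raw U n) : Raw U n
  | kapp {U : World} {n : ℕ} (M : Raw U n) (κ : Fin U.card) : Raw U n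
  | pair {U : World} {n : ℕ} (M N : Raw U n) : Raw U n
  | fst {U : World} {n : ℕ} (M : Raw U n) : Raw U n
  | snd {U : World} {n : ℕ} (M : Raw U n) : Raw U n
  | fix {U : World} {n : ℕ} (M : Raw U (n + 1)) : Raw U n
  | star {U : World} {n : ℕ} : Raw U n
  | tt {U : World} {n : ℕ} : Raw U n
  | ff {U : World} {n : ℕ} : Raw U n
  | ifb {U : World} {n : ℕ} (Mb Mt Mf : Raw U n) : Raw U n
  | ze {U : World} {n : ℕ} : Raw U n
  | su {U : World} {n : ℕ} (M : Raw U n) : Raw U n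
  | ifze {U : World} {n : ℕ} (Mn Mz : Raw U n) (Ms : Raw U (n + 1)) : Raw U n
  | sup {U : World} {n : ℕ} (M : Raw U n) (N : Raw U (n + 1)) : Raw U n
  | wrec {U : World} {n : ℕ} (M : Raw U n) (N : Raw U (n + 3)) : Raw U n
  | pi {U : World} {n : ℕ} (A : Raw U n) (B : Raw U (n + 1)) : Raw U n
  | sg {U : World} {n : ℕ} (A : Raw U n) (B : Raw U (n + 1)) : Raw U n
  | wty {U : World} {n : ℕ} (A : Raw U n) (B : Raw U (n + 1)) : Raw U n
  | eqty {U : World} {n : ℕ} (A M N : Raw U n) : Raw U n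
  | kprod {U : World} {n : ℕ} (A : (V : World) → (V ⟶ U) → Fin V.card → Raw V n) : Raw U n
  | isect {U : World} {n : ℕ} (A : (V : World) → (V ⟶ U) → Fin V.card → Raw V n) : Raw U n
  | later {U : World} {n : ℕ} (κ : Fin U.card) (A : Raw U n) : Raw U n
  | void {U : World} {n : ℕ} : Raw U n
  | unit {U : World} {n : ℕ} : Raw U n
  | bool {U : World} {n : ℕ} : Raw U n
  | nat {U : World} {n : ℕ} : Raw U n
  | univ {U : World} {n : ℕ} (i : ℕ) : Raw U n

namespace Raw

/-- Restriction of raw trees along a morphism of worlds. -/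
def res : {U : World} → {n : ℕ} → Raw U n → {V : World} → (V ⟶ U) → Raw V n
  | _, _, var i, _, _ => var i
  | _, _, lam M, _, ρ => lam (M.res ρ)
  | _, _, klam M, _, ρ => klam fun W σ κ => M W (σ ≫ ρ) κ
  | _, _, app M N, _, ρ => app (M.res ρ) (N.res ρ)
  | _, _, kapp M κ, _, ρ => kapp (M.res ρ) (act ρ κ)
  | _, _, pair M N, _, ρ => pair (M.res ρ) (N.res ρ)
  | _, _, fst M, _, ρ => fst (M.res ρ)
  | _, _, snd M, _, ρ => snd (M.res ρ)
  | _, _, fix M, _, ρ => fix (M.res ρ)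
  | _, _, star, _, _ => star
  | _, _, tt, _, _ => tt
  | _, _, ff, _, _ => ff
  | _, _, ifb Mb Mt Mf, _, ρ => ifb (Mb.res ρ) (Mt.res ρ) (Mf.res ρ)
  | _, _, ze, _, _ => ze
  | _, _, su M, _, ρ => su (M.res ρ)
  | _, _, ifze Mn Mz Ms, _, ρ => ifze (Mn.res ρ) (Mz.res ρ) (Ms.res ρ)
  | _, _, sup M N, _, ρ => sup (M.res ρ) (N.res ρ)
  | _, _, wrec M N, _, ρ => wrec (M.res ρ) (N.res ρ)
  | _, _, pi A B, _, ρ => pi (A.res ρ) (B.res ρ)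
  | _, _, sg A B, _, ρ => sg (A.res ρ) (B.res ρ)
  | _, _, wty A B, _, ρ => wty (A.res ρ) (B.res ρ)
  | _, _, eqty A M N, _, ρ => eqty (A.res ρ) (M.res ρ) (N.res ρ)
  | _, _, kprod A, _, ρ => kprod fun W σ κ => A W (σ ≫ ρ) κ
  | _, _, isect A, _, ρ => isect fun W σ κ => A W (σ ≫ ρ) κ
  | _, _, later κ A, _, ρ => later (act ρ κ) (A.res ρ)
  | _, _, void, _, _ => void
  | _, _, unit, _, _ => unit
  | _, _, bool, _, _ => bool
  | _, _, nat, _, _ => nat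
  | _, _, univ i, _, _ => univ i

/-- Hereditary naturality: every family of subtrees bound by a clock binder is a natural
transformation `y(U) × Clk ⟶ Tm n`, i.e. an element of the exponential `(Tm n) ^ Clk` at `U`. -/
def Natural : {U : World} → {n : ℕ} → Raw U n → Prop
  | _, _, var _ => True
  | _, _, lam M => M.Natural
  | _, _, klam M => (∀ V ρ κ, (M V ρ κ).Natural) ∧
      ∀ V W (ρ : V ⟶ _) (σ : W ⟶ V) κ, (M V ρ κ).res σ = M W (σ ≫ ρ) (act σ κ)
  | _, _, app M N => M.Natural ∧ N.Natural
  | _, _, kapp M _ => M.Natural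
  | _, _, pair M N => M.Natural ∧ N.Natural
  | _, _, fst M => M.Natural
  | _, _, snd M => M.Natural
  | _, _, fix M => M.Natural
  | _, _, star => True
  | _, _, tt => True
  | _, _, ff => True
  | _, _, ifb Mb Mt Mf => Mb.Natural ∧ Mt.Natural ∧ Mf.Natural
  | _, _, ze => True
  | _, _, su M => M.Natural
  | _, _, ifze Mn Mz Ms => Mn.Natural ∧ Mz.Natural ∧ Ms.Natural
  | _, _, sup M N => M.Natural ∧ N.Natural
  | _, _, wrec M N => M.Natural ∧ N.Natural
  | _, _, pi A B => A.Natural ∧ B.Natural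
  | _, _, sg A B => A.Natural ∧ B.Natural
  | _, _, wty A B => A.Natural ∧ B.Natural
  | _, _, eqty A M N => A.Natural ∧ M.Natural ∧ N.Natural
  | _, _, kprod A => (∀ V ρ κ, (A V ρ κ).Natural) ∧
      ∀ V W (ρ : V ⟶ _) (σ : W ⟶ V) κ, (A V ρ κ).res σ = A W (σ ≫ ρ) (act σ κ)
  | _, _, isect A => (∀ V ρ κ, (A V ρ κ).Natural) ∧
      ∀ V W (ρ : V ⟶ _) (σ : W ⟶ V) κ, (A V ρ κ).res σ = A W (σ ≫ ρ) (act σ κ)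
  | _, _, later _ A => A.Natural
  | _, _, void => True
  | _, _, unit => True
  | _, _, bool => True
  | _, _, nat => True
  | _, _, univ _ => True

theorem res_id {U : World} {n : ℕ} (M : Raw U n) : M.res (𝟙 U) = M := by
  induction M <;> simp only [res, Category.comp_id, act_id, *]

theorem res_res {U V W : World} {n : ℕ} (M : Raw U n) (ρ : V ⟶ U) (σ : W ⟶ V) :
    (M.res ρ).res σ = M.res (σ ≫ ρ) := by
  induction M generalizing V W <;> simp only [res, Category.assoc, act_comp, *]

theorem Natural.res {U V : World} {n : ℕ} {M : Raw U n} (h : M.Natural) (ρ : V ⟶ U) :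
    (M.res ρ).Natural := by
  induction M generalizing V <;> simp only [Raw.res, Natural, Category.assoc] at h ⊢ <;> grind

/-- Weakening a renaming under a binder. The most recently bound variable has index `0`. -/
def liftRen {m n : ℕ} (r : Fin m → Fin n) : Fin (m + 1) → Fin (n + 1) :=
  Fin.cases 0 fun i => (r i).succ

/-- Renaming of variables. -/
def rename : {U : World} → {m : ℕ} → Raw U m → {n : ℕ} → (Fin m → Fin n) → Raw U n
  | _, _, var i, _, r => var (r i)
  | _, _, lam M, _, r => lam (M.rename (liftRen r))
  | _, _, klam M, _, r => klam fun W σ κ => (M W σ κ).rename r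
  | _, _, app M N, _, r => app (M.rename r) (N.rename r)
  | _, _, kapp M κ, _, r => kapp (M.rename r) κ
  | _, _, pair M N, _, r => pair (M.rename r) (N.rename r)
  | _, _, fst M, _, r => fst (M.rename r)
  | _, _, snd M, _, r => snd (M.rename r)
  | _, _, fix M, _, r => fix (M.rename (liftRen r))
  | _, _, star, _, _ => star
  | _, _, tt, _, _ => tt
  | _, _, ff, _, _ => ff
  | _, _, ifb Mb Mt Mf, _, r => ifb (Mb.rename r) (Mt.rename r) (Mf.rename r)
  | _, _, ze, _, _ => ze
  | _, _, su M, _, r => su (M.rename r)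
  | _, _, ifze Mn Mz Ms, _, r => ifze (Mn.rename r) (Mz.rename r) (Ms.rename (liftRen r))
  | _, _, sup M N, _, r => sup (M.rename r) (N.rename (liftRen r))
  | _, _, wrec M N, _, r => wrec (M.rename r) (N.rename (liftRen (liftRen (liftRen r))))
  | _, _, pi A B, _, r => pi (A.rename r) (B.rename (liftRen r))
  | _, _, sg A B, _, r => sg (A.rename r) (B.rename (liftRen r))
  | _, _, wty A B, _, r => wty (A.rename r) (B.rename (liftRen r))
  | _, _, eqty A M N, _, r => eqty (A.rename r) (M.rename r) (N.rename r)
  | _, _, kprod A, _, r => kprod fun W σ κ => (A W σ κ).rename r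
  | _, _, isect A, _, r => isect fun W σ κ => (A W σ κ).rename r
  | _, _, later κ A, _, r => later κ (A.rename r)
  | _, _, void, _, _ => void
  | _, _, unit, _, _ => unit
  | _, _, bool, _, _ => bool
  | _, _, nat, _, _ => nat
  | _, _, univ i, _, _ => univ i

/-- Weakening a substitution under a variable binder. -/
def liftSub {U : World} {m n : ℕ} (γ : Fin m → Raw U n) : Fin (m + 1) → Raw U (n + 1) :=
  Fin.cases (var 0) fun i => (γ i).rename Fin.succ

/-- Simultaneous capture-avoiding substitution. -/
def subst : {U : World} → {m : ℕ} → Raw U m → {n : ℕ} → (Fin m → Raw U n) → Raw U n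
  | _, _, var i, _, γ => γ i
  | _, _, lam M, _, γ => lam (M.subst (liftSub γ))
  | _, _, klam M, _, γ => klam fun W σ κ => (M W σ κ).subst fun i => (γ i).res σ
  | _, _, app M N, _, γ => app (M.subst γ) (N.subst γ)
  | _, _, kapp M κ, _, γ => kapp (M.subst γ) κ
  | _, _, pair M N, _, γ => pair (M.subst γ) (N.subst γ)
  | _, _, fst M, _, γ => fst (M.subst γ)
  | _, _, snd M, _, γ => snd (M.subst γ)
  | _, _, fix M, _, γ => fix (M.subst (liftSub γ))
  | _, _, star, _, _ => star
  | _, _, tt, _, _ => tt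
  | _, _, ff, _, _ => ff
  | _, _, ifb Mb Mt Mf, _, γ => ifb (Mb.subst γ) (Mt.subst γ) (Mf.subst γ)
  | _, _, ze, _, _ => ze
  | _, _, su M, _, γ => su (M.subst γ)
  | _, _, ifze Mn Mz Ms, _, γ => ifze (Mn.subst γ) (Mz.subst γ) (Ms.subst (liftSub γ))
  | _, _, sup M N, _, γ => sup (M.subst γ) (N.subst (liftSub γ))
  | _, _, wrec M N, _, γ => wrec (M.subst γ) (N.subst (liftSub (liftSub (liftSub γ))))
  | _, _, pi A B, _, γ => pi (A.subst γ) (B.subst (liftSub γ))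
  | _, _, sg A B, _, γ => sg (A.subst γ) (B.subst (liftSub γ))
  | _, _, wty A B, _, γ => wty (A.subst γ) (B.subst (liftSub γ))
  | _, _, eqty A M N, _, γ => eqty (A.subst γ) (M.subst γ) (N.subst γ)
  | _, _, kprod A, _, γ => kprod fun W σ κ => (A W σ κ).subst fun i => (γ i).res σ
  | _, _, isect A, _, γ => isect fun W σ κ => (A W σ κ).subst fun i => (γ i).res σ
  | _, _, later κ A, _, γ => later κ (A.subst γ)
  | _, _, void, _, _ => void
  | _, _, unit, _, _ => unit
  | _, _, bool, _, _ => bool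
  | _, _, nat, _, _ => nat
  | _, _, univ i, _, _ => univ i

theorem res_rename {U V : World} {m n : ℕ} (M : Raw U m) (r : Fin m → Fin n) (ρ : V ⟶ U) :
    (M.rename r).res ρ = (M.res ρ).rename r := by
  induction M generalizing V n <;> simp only [res, rename, *]

theorem Natural.rename {U : World} {m n : ℕ} {M : Raw U m} (h : M.Natural) (r : Fin m → Fin n) :
    (M.rename r).Natural := by
  induction M generalizing n <;> simp only [Raw.rename, Natural, res_rename] at h ⊢ <;> grind

theorem res_liftSub {U V : World} {m n : ℕ} (γ : Fin m → Raw U n) (ρ : V ⟶ U) :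
    (fun i => (liftSub γ i).res ρ) = liftSub fun i => (γ i).res ρ := by
  funext i
  refine Fin.cases ?_ (fun i => ?_) i <;> simp [liftSub, res, res_rename]

theorem res_subst {U V : World} {m n : ℕ} (M : Raw U m) (γ : Fin m → Raw U n) (ρ : V ⟶ U) :
    (M.subst γ).res ρ = (M.res ρ).subst fun i => (γ i).res ρ := by
  induction M generalizing V n <;> simp only [res, subst, ← res_liftSub, res_res, *]

theorem Natural.liftSub {U : World} {m n : ℕ} {γ : Fin m → Raw U n}
    (h : ∀ i, (γ i).Natural) (i : Fin (m + 1)) : (liftSub γ i).Natural := by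
  refine Fin.cases ?_ (fun i => ?_) i
  · simp [Raw.liftSub, Natural]
  · simpa [Raw.liftSub] using (h i).rename _

theorem Natural.subst {U : World} {m n : ℕ} {M : Raw U m} (h : M.Natural)
    {γ : Fin m → Raw U n} (hγ : ∀ i, (γ i).Natural) : (M.subst γ).Natural := by
  induction M generalizing n
  case wrec M N ihM ihN =>
    exact ⟨ihM h.1 hγ, ihN h.2 (Natural.liftSub (Natural.liftSub (Natural.liftSub hγ)))⟩
  all_goals simp only [Raw.subst, Natural, res_subst, res_res] at h ⊢
  all_goals grind [Natural.liftSub, Natural.res]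

end Raw

/-! ### Operational semantics of closed programs -/

namespace Raw

/-- Canonical forms. -/
inductive Val {U : World} : Raw U 0 → Prop
  | lam (M) : Val (lam M)
  | klam (M) : Val (klam M)
  | pair (M N) : Val (pair M N)
  | star : Val star
  | tt : Val tt
  | ff : Val ff
  | ze : Val ze
  | su (M) : Val (su M)
  | sup (M N) : Val (sup M N)
  | pi (A B) : Val (pi A B)
  | sg (A B) : Val (sg A B)
  | wty (A B) : Val (wty A B)
  | eqty (A M N) : Val (eqty A M N)
  | kprod (A) : Val (kprod A)
  | isect (A) : Val (isect A)
  | later (κ A) : Val (later κ A)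
  | void : Val void
  | unit : Val unit
  | bool : Val bool
  | nat : Val nat
  | univ (i) : Val (univ i)

/-- Instantiation of the only free variable of `M` by `N`. -/
def inst {U : World} (M : Raw U 1) (N : Raw U 0) : Raw U 0 := M.subst fun _ => N

/-- The instance `[M, λ N, λ x. wrec (N x) O] O` of the body `O` of a wellordering recursor at
`sup M N`; the variables `x, y, z` of `O` have indices `2, 1, 0`. -/
def wrecInst {U : World} (M : Raw U 0) (N : Raw U 1) (O : Raw U 3) : Raw U 0 :=
  O.subst ![lam (wrec N (O.rename (Fin.castSucc : Fin 3 → Fin 4))), lam N, M]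

/-- The small-step transition relation. -/
inductive Step {U : World} : Raw U 0 → Raw U 0 → Prop
  | app_cong {M M' : Raw U 0} (N) : Step M M' → Step (app M N) (app M' N)
  | kapp_cong {M M' : Raw U 0} (κ) : Step M M' → Step (kapp M κ) (kapp M' κ)
  | fst_cong {M M' : Raw U 0} : Step M M' → Step (fst M) (fst M')
  | snd_cong {M M' : Raw U 0} : Step M M' → Step (snd M) (snd M')
  | ifb_cong {M M' : Raw U 0} (Mt Mf) : Step M M' → Step (ifb M Mt Mf) (ifb M' Mt Mf)
  | ifze_cong {M M' : Raw U 0} (Mz Ms) : Step M M' → Step (ifze M Mz Ms) (ifze M' Mz Ms)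
  | wrec_cong {M M' : Raw U 0} (N) : Step M M' → Step (wrec M N) (wrec M' N)
  | app_lam (M : Raw U 1) (N : Raw U 0) : Step (app (lam M) N) (M.inst N)
  | kapp_klam (M) (κ : Fin U.card) : Step (kapp (klam M) κ) (M U (𝟙 U) κ)
  | fst_pair (M N : Raw U 0) : Step (fst (pair M N)) M
  | snd_pair (M N : Raw U 0) : Step (snd (pair M N)) N
  | ifb_tt (Mt Mf : Raw U 0) : Step (ifb tt Mt Mf) Mt
  | ifb_ff (Mt Mf : Raw U 0) : Step (ifb ff Mt Mf) Mf
  | ifze_ze (Mz : Raw U 0) (Ms : Raw U 1) : Step (ifze ze Mz Ms) Mz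
  | ifze_su (M Mz : Raw U 0) (Ms : Raw U 1) : Step (ifze (su M) Mz Ms) (Ms.inst M)
  | wrec_sup (M : Raw U 0) (N : Raw U 1) (O : Raw U 3) :
      Step (wrec (sup M N) O) (wrecInst M N O)
  | fix (M : Raw U 1) : Step (fix M) (M.inst (fix M))

theorem Val.res {U V : World} {M : Raw U 0} (h : M.Val) (ρ : V ⟶ U) : (M.res ρ).Val := by
  cases h <;> constructor

theorem Step.res {U V : World} {M N : Raw U 0} (h : Step M N) (hM : M.Natural) (ρ : V ⟶ U) :
    Step (M.res ρ) (N.res ρ) := by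
  induction h
  case app_cong N _ ih => exact .app_cong _ (ih hM.1)
  case kapp_cong ih => exact .kapp_cong _ (ih hM)
  case fst_cong ih => exact .fst_cong (ih hM)
  case snd_cong ih => exact .snd_cong (ih hM)
  case ifb_cong ih => exact .ifb_cong _ _ (ih hM.1)
  case ifze_cong ih => exact .ifze_cong _ _ (ih hM.1)
  case wrec_cong ih => exact .wrec_cong _ (ih hM.1)
  case app_lam M N => rw [inst, res_subst]; exact .app_lam _ _
  case kapp_klam M κ =>
    have := Step.kapp_klam (U := V) (fun W σ κ => M W (σ ≫ ρ) κ) (act ρ κ)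
    rw [hM.2 U V (𝟙 U) ρ κ]
    simpa [Raw.res] using this
  case fst_pair => exact .fst_pair _ _
  case snd_pair => exact .snd_pair _ _
  case ifb_tt => exact .ifb_tt _ _
  case ifb_ff => exact .ifb_ff _ _
  case ifze_ze => exact .ifze_ze _ _
  case ifze_su M Mz Ms => rw [inst, res_subst]; exact .ifze_su _ _ _
  case wrec_sup M N O =>
    have : (wrecInst M N O).res ρ = wrecInst (M.res ρ) (N.res ρ) (O.res ρ) := by
      rw [wrecInst, res_subst, wrecInst]
      congr 1
      funext i
      fin_cases i <;> simp [Raw.res, res_rename]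
    rw [this]; exact .wrec_sup _ _ _
  case fix M => rw [inst, res_subst]; exact .fix _

end Raw

/-- The programs with `n` free variables at world `U`. -/
def Tm (U : World) (n : ℕ) : Type := {M : Raw U n // M.Natural}

/-- Restriction of programs along a morphism of worlds. -/
def Tm.res {U V : World} {n : ℕ} (M : Tm U n) (ρ : V ⟶ U) : Tm V n := ⟨M.1.res ρ, M.2.res ρ⟩

@[simp] theorem Tm.res_id {U : World} {n : ℕ} (M : Tm U n) : M.res (𝟙 U) = M :=
  Subtype.ext (Raw.res_id _)

@[simp] theorem Tm.res_res {U V W : World} {n : ℕ} (M : Tm U n) (ρ : V ⟶ U) (σ : W ⟶ V) :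
    (M.res ρ).res σ = M.res (σ ≫ ρ) :=
  Subtype.ext (Raw.res_res _ _ _)

/-- The object of programs with `n` free variables: the indexed W-type, internal to the topos,
whose clock-binding constructors take arguments in the exponential `(tmObj n) ^ clkObj`. -/
abbrev tmObj (n : ℕ) : ClkTopos where
  obj U := Tm U.unop n
  map f := TypeCat.ofHom fun M => M.res f.unop
  map_id U := by ext M; simp
  map_comp f g := by ext M; simp

namespace Tm
variable {U V W : World} {n m : ℕ}

def app (M N : Tm U n) : Tm U n := ⟨.app M.1 N.1, M.2, N.2⟩
def kapp (M : Tm U n) (κ : Fin U.card) : Tm U n := ⟨.kapp M.1 κ, M.2⟩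
def fst (M : Tm U n) : Tm U n := ⟨.fst M.1, M.2⟩
def snd (M : Tm U n) : Tm U n := ⟨.snd M.1, M.2⟩
def star : Tm U n := ⟨.star, trivial⟩
def tt : Tm U n := ⟨.tt, trivial⟩
def ff : Tm U n := ⟨.ff, trivial⟩
def ze : Tm U n := ⟨.ze, trivial⟩
def su (M : Tm U n) : Tm U n := ⟨.su M.1, M.2⟩
def sup (M : Tm U n) (N : Tm U (n + 1)) : Tm U n := ⟨.sup M.1 N.1, M.2, N.2⟩
def pi (A : Tm U n) (B : Tm U (n + 1)) : Tm U n := ⟨.pi A.1 B.1, A.2, B.2⟩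
def sg (A : Tm U n) (B : Tm U (n + 1)) : Tm U n := ⟨.sg A.1 B.1, A.2, B.2⟩
def wty (A : Tm U n) (B : Tm U (n + 1)) : Tm U n := ⟨.wty A.1 B.1, A.2, B.2⟩
def eqty (A M N : Tm U n) : Tm U n := ⟨.eqty A.1 M.1 N.1, A.2, M.2, N.2⟩
def kprod (A : Exp clkObj (tmObj n) U) : Tm U n :=
  ⟨.kprod fun _ ρ κ => (A.app ρ κ).1, fun _ ρ κ => (A.app ρ κ).2,
    fun _ _ ρ σ κ => congrArg Subtype.val (A.natural ρ σ κ)⟩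
def isect (A : Exp clkObj (tmObj n) U) : Tm U n :=
  ⟨.isect fun _ ρ κ => (A.app ρ κ).1, fun _ ρ κ => (A.app ρ κ).2,
    fun _ _ ρ σ κ => congrArg Subtype.val (A.natural ρ σ κ)⟩
def later (κ : Fin U.card) (A : Tm U n) : Tm U n := ⟨.later κ A.1, A.2⟩
def void : Tm U n := ⟨.void, trivial⟩
def unit : Tm U n := ⟨.unit, trivial⟩
def bool : Tm U n := ⟨.bool, trivial⟩
def nat : Tm U n := ⟨.nat, trivial⟩
def univ (i : ℕ) : Tm U n := ⟨.univ i, trivial⟩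

/-- Simultaneous substitution of programs. -/
def subst (M : Tm U m) (γ : Fin m → Tm U n) : Tm U n :=
  ⟨M.1.subst fun i => (γ i).1, M.2.subst fun i => (γ i).2⟩

/-- Instantiation of the only free variable of `M` by `N`. -/
def inst (M : Tm U 1) (N : Tm U 0) : Tm U 0 := M.subst fun _ => N

theorem res_subst (M : Tm U m) (γ : Fin m → Tm U n) (ρ : V ⟶ U) :
    (M.subst γ).res ρ = (M.res ρ).subst fun i => (γ i).res ρ :=
  Subtype.ext (Raw.res_subst _ _ _)

theorem res_inst (M : Tm U 1) (N : Tm U 0) (ρ : V ⟶ U) :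
    (M.inst N).res ρ = (M.res ρ).inst (N.res ρ) := res_subst _ _ _

def Val (M : Tm U 0) : Prop := M.1.Val

def Step (M N : Tm U 0) : Prop := M.1.Step N.1

/-- The reflexive-transitive closure of the transition relation. -/
def Steps : Tm U 0 → Tm U 0 → Prop := Relation.ReflTransGen Step

theorem Steps.res {M N : Tm U 0} (h : Steps M N) (ρ : V ⟶ U) : Steps (M.res ρ) (N.res ρ) := by
  induction h with
  | refl => exact .refl
  | tail _ h ih => exact ih.tail (Raw.Step.res h (Subtype.property _) ρ)

/-- Evaluation to a canonical form. -/
def Eval (M N : Tm U 0) : Prop := Steps M N ∧ N.Val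

theorem Eval.res {M N : Tm U 0} (h : Eval M N) (ρ : V ⟶ U) : Eval (M.res ρ) (N.res ρ) :=
  ⟨h.1.res ρ, Raw.Val.res h.2 ρ⟩

/-- Approximation of closed programs, forced at world `U`. -/
def ClosedApprox (M₀ M₁ : Tm U 0) : Prop :=
  ∀ (V : World) (ρ : V ⟶ U) (N : Tm V 0), N.Val → Steps (M₀.res ρ) N → Steps (M₁.res ρ) N

/-- Computational (Kleene) equivalence of closed programs, forced at world `U`. -/
def ClosedSq (M₀ M₁ : Tm U 0) : Prop := ClosedApprox M₀ M₁ ∧ ClosedApprox M₁ M₀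

/-- Computational equivalence of open programs, forced at world `U`. -/
def OpenSq (M₀ M₁ : Tm U n) : Prop :=
  ∀ (V : World) (ρ : V ⟶ U) (γ : Fin n → Tm V 0),
    ClosedSq ((M₀.res ρ).subst γ) ((M₁.res ρ).subst γ)

end Tm

/-! ## Candidate type systems and the closure operator -/

/-- The object of binary relations on closed programs. -/
abbrev relObj : ClkTopos := powObj (prodObj (tmObj 0) (tmObj 0))

/-- Binary relations on closed programs at world `U`. -/
abbrev Rel (U : World) := Pow (prodObj (tmObj 0) (tmObj 0)) U

/-- Candidate type systems at world `U`. -/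
abbrev CTS (U : World) := Pow (prodObj (tmObj 0) relObj) U

section Relations
variable {U V W : World}

theorem rel_closed (A : Rel U) (ρ : V ⟶ U) (σ : W ⟶ V) {M N : Tm V 0} (h : A.mem ρ (M, N)) :
    A.mem (σ ≫ ρ) (M.res σ, N.res σ) := A.closed ρ σ _ h

@[simp] theorem rel_mem_res (A : Rel U) (ρ : V ⟶ U) (σ : W ⟶ V) (M N : Tm W 0) :
    Pow.mem (Pow.res A ρ) σ (M, N) ↔ A.mem (σ ≫ ρ) (M, N) := Iff.rfl

@[simp] theorem cts_mem_res (τ : CTS U) (ρ : V ⟶ U) (σ : W ⟶ V) (A : Tm W 0) (X : Rel W) :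
    Pow.mem (Pow.res τ ρ) σ (A, X) ↔ τ.mem (σ ≫ ρ) (A, X) := Iff.rfl

/-- Comprehension of a relation from a predicate that is stable under restriction. -/
def relOf (R : ∀ {V : World}, (V ⟶ U) → Tm V 0 → Tm V 0 → Prop)
    (h : ∀ {V W : World} (ρ : V ⟶ U) (σ : W ⟶ V) (M N : Tm V 0),
      R ρ M N → R (σ ≫ ρ) (M.res σ) (N.res σ)) : Rel U where
  mem ρ x := R ρ x.1 x.2
  closed ρ σ x hx := h ρ σ x.1 x.2 hx

/-- Comprehension of a candidate type system from a predicate that is stable under restriction. -/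
def ctsOf (R : ∀ {V : World}, (V ⟶ U) → Tm V 0 → Rel V → Prop)
    (h : ∀ {V W : World} (ρ : V ⟶ U) (σ : W ⟶ V) (A : Tm V 0) (X : Rel V),
      R ρ A X → R (σ ≫ ρ) (A.res σ) (X.res σ)) : CTS U where
  mem ρ x := R ρ x.1 x.2
  closed ρ σ x hx := h ρ σ x.1 x.2 hx

theorem Exp.app_res {Y : ClkTopos} (B : Exp Y relObj U) (ρ : V ⟶ U) (σ : W ⟶ V)
    (y : Y.obj (op V)) : (B.app ρ y).res σ = B.app (σ ≫ ρ) (Y.map σ.op y) := B.natural ρ σ y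

/-- Closure of a relation under evaluation to canonical form. -/
def valClo (R : Rel U) : Rel U :=
  relOf (fun ρ M₀ M₁ => ∃ N₀ N₁, M₀.Eval N₀ ∧ M₁.Eval N₁ ∧ R.mem ρ (N₀, N₁)) (by
    rintro V W ρ σ M N ⟨N₀, N₁, h₀, h₁, h⟩
    exact ⟨_, _, h₀.res σ, h₁.res σ, R.closed ρ σ _ h⟩)

/-- Closure of a candidate type system under evaluation to canonical form. -/
def ctsValClo (τ : CTS U) : CTS U :=
  ctsOf (fun ρ A X => ∃ A', A.Eval A' ∧ τ.mem ρ (A', X)) (by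
    rintro V W ρ σ A X ⟨A', h₀, h⟩
    exact ⟨_, h₀.res σ, τ.closed ρ σ _ h⟩)

theorem valClo_res (R : Rel U) (ρ : V ⟶ U) : (valClo R).res ρ = valClo (R.res ρ) := rfl

def voidRel (U : World) : Rel U := relOf (fun _ _ _ => False) (by intros; assumption)

def unitRel (U : World) : Rel U := relOf (fun _ M₀ M₁ => M₀ = .star ∧ M₁ = .star) (by
  rintro V W ρ σ _ _ ⟨rfl, rfl⟩; exact ⟨rfl, rfl⟩)

def boolRel (U : World) : Rel U :=
  relOf (fun _ M₀ M₁ => (M₀ = .tt ∧ M₁ = .tt) ∨ (M₀ = .ff ∧ M₁ = .ff)) (by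
    rintro V W ρ σ _ _ (⟨rfl, rfl⟩ | ⟨rfl, rfl⟩)
    exacts [.inl ⟨rfl, rfl⟩, .inr ⟨rfl, rfl⟩])

def natStep (Y : Rel U) : Rel U :=
  relOf (fun ρ M₀ M₁ => (M₀ = .ze ∧ M₁ = .ze) ∨
      ∃ N₀ N₁, M₀ = .su N₀ ∧ M₁ = .su N₁ ∧ (valClo Y).mem ρ (N₀, N₁)) (by
    rintro V W ρ σ _ _ (⟨rfl, rfl⟩ | ⟨N₀, N₁, rfl, rfl, h⟩)
    exacts [.inl ⟨rfl, rfl⟩, .inr ⟨_, _, rfl, rfl, (valClo Y).closed ρ σ _ h⟩])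

def natRel (U : World) : Rel U := Pow.lfp fun _ Y => natStep Y

def sgRel (A : Rel U) (B : Exp (tmObj 0) relObj U) : Rel U :=
  relOf (fun {V} ρ M₀ M₁ => A.mem ρ (M₀.fst, M₁.fst) ∧
      (B.app ρ M₀.fst).mem (𝟙 V) (M₀.snd, M₁.snd)) (by
    rintro V W ρ σ M N ⟨h₁, h₂⟩
    refine ⟨A.closed ρ σ _ h₁, ?_⟩
    have := (B.app ρ M.fst).closed _ σ _ h₂
    rw [Category.comp_id, ← Category.id_comp σ, ← Pow.res_mem, Exp.app_res] at this
    exact this)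

def piRel (A : Rel U) (B : Exp (tmObj 0) relObj U) : Rel U :=
  relOf (fun {V} ρ M₀ M₁ => ∀ (W : World) (σ : W ⟶ V) (N₀ N₁ : Tm W 0),
      A.mem (σ ≫ ρ) (N₀, N₁) →
        (B.app (σ ≫ ρ) N₀).mem (𝟙 W) ((M₀.res σ).app N₀, (M₁.res σ).app N₁)) (by
    intro V W ρ σ M N h W' σ' N₀ N₁ hN
    simpa using h W' (σ' ≫ σ) N₀ N₁ (by simpa using hN))

def wStep (A : Rel U) (B : Exp (tmObj 0) relObj U) (Y : Rel U) : Rel U :=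
  relOf (fun {V} ρ P₀ P₁ => ∃ M₀ M₁ N₀ N₁, P₀ = .sup M₀ N₀ ∧ P₁ = .sup M₁ N₁ ∧
      A.mem ρ (M₀, M₁) ∧
      ∀ (W : World) (σ : W ⟶ V) (O₀ O₁ : Tm W 0), (B.app ρ M₀).mem σ (O₀, O₁) →
        (valClo Y).mem (σ ≫ ρ) ((N₀.res σ).inst O₀, (N₁.res σ).inst O₁)) (by
    rintro V W ρ σ _ _ ⟨M₀, M₁, N₀, N₁, rfl, rfl, hM, h⟩
    refine ⟨M₀.res σ, M₁.res σ, N₀.res σ, N₁.res σ, rfl, rfl, A.closed ρ σ _ hM, ?_⟩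
    intro W' σ' O₀ O₁ hO
    have e : B.app (σ ≫ ρ) (M₀.res σ) = (B.app ρ M₀).res σ := (Exp.app_res B ρ σ M₀).symm
    rw [e] at hO
    simpa using h W' (σ' ≫ σ) O₀ O₁ hO)

def wRel (A : Rel U) (B : Exp (tmObj 0) relObj U) : Rel U :=
  Pow.lfp fun ρ Y => wStep (A.res ρ) (B.res ρ) Y

def eqRel (A : Rel U) (M₀ M₁ : Tm U 0) : Rel U :=
  relOf (fun ρ P₀ P₁ => P₀ = .star ∧ P₁ = .star ∧ A.mem ρ (M₀.res ρ, M₁.res ρ)) (by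
    rintro V W ρ σ _ _ ⟨rfl, rfl, h⟩
    refine ⟨rfl, rfl, ?_⟩
    simpa using rel_closed A ρ σ h)

def laterRel (κ : Fin U.card) (A : Rel U) : Rel U :=
  relOf (fun {V} ρ M₀ M₁ =>
      Later V (act ρ κ) fun σ => A.mem (σ ≫ ρ) (M₀.res σ, M₁.res σ)) (by
    intro V W ρ σ M N h
    have := h.mono (fun {V' W'} ρ' σ' h' => by simpa using rel_closed A (ρ' ≫ ρ) σ' h') σ
    simpa using this)

def isectRel (A : Exp clkObj relObj U) : Rel U :=
  relOf (fun {V} ρ M₀ M₁ => ∀ (W : World) (σ : W ⟶ V) (κ : Fin W.card),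
      (A.app (σ ≫ ρ) κ).mem (𝟙 W) (M₀.res σ, M₁.res σ)) (by
    intro V W ρ σ M N h W' σ' κ
    simpa using h W' (σ' ≫ σ) κ)

def kprodRel (A : Exp clkObj relObj U) : Rel U :=
  relOf (fun {V} ρ M₀ M₁ => ∀ (W : World) (σ : W ⟶ V) (κ : Fin W.card),
      (A.app (σ ≫ ρ) κ).mem (𝟙 W) ((M₀.res σ).kapp κ, (M₁.res σ).kapp κ)) (by
    intro V W ρ σ M N h W' σ' κ
    simpa using h W' (σ' ≫ σ) κ)

/-! ### The clauses for the type connectives other than universes, forced at world `U` -/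

variable (τ : CTS U) (T : Tm U 0) (X : Rel U)

def CloVoid : Prop := T = .void ∧ X = voidRel U

def CloUnit : Prop := T = .unit ∧ X = valClo (unitRel U)

def CloBool : Prop := T = .bool ∧ X = valClo (boolRel U)

def CloNat : Prop := T = .nat ∧ X = valClo (natRel U)

/-- Functionality of the family `B` of types over `𝒜`, with the family of relations `ℬ`. -/
def Family (𝒜 : Rel U) (B : Tm U 1) (ℬ : Exp (tmObj 0) relObj U) : Prop :=
  ∀ (V : World) (ρ : V ⟶ U) (M₀ M₁ : Tm V 0), 𝒜.mem ρ (M₀, M₁) →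
    τ.mem ρ ((B.res ρ).inst M₀, ℬ.app ρ M₀) ∧ τ.mem ρ ((B.res ρ).inst M₁, ℬ.app ρ M₀) ∧
    τ.mem ρ ((B.res ρ).inst M₁, ℬ.app ρ M₁) ∧ τ.mem ρ ((B.res ρ).inst M₀, ℬ.app ρ M₁)

def CloProd : Prop :=
  ∃ (A : Tm U 0) (B : Tm U 1) (𝒜 : Rel U) (ℬ : Exp (tmObj 0) relObj U),
    T = .sg A B ∧ τ.mem (𝟙 U) (A, 𝒜) ∧ Family τ 𝒜 B ℬ ∧ X = sgRel 𝒜 ℬ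

def CloFun : Prop :=
  ∃ (A : Tm U 0) (B : Tm U 1) (𝒜 : Rel U) (ℬ : Exp (tmObj 0) relObj U),
    T = .pi A B ∧ τ.mem (𝟙 U) (A, 𝒜) ∧ Family τ 𝒜 B ℬ ∧ X = piRel 𝒜 ℬ

def CloW : Prop :=
  ∃ (A : Tm U 0) (B : Tm U 1) (𝒜 : Rel U) (ℬ : Exp (tmObj 0) relObj U),
    T = .wty A B ∧ τ.mem (𝟙 U) (A, 𝒜) ∧ Family τ 𝒜 B ℬ ∧ X = valClo (wRel 𝒜 ℬ)

def CloEq : Prop :=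
  ∃ (A M₀ M₁ : Tm U 0) (𝒜 : Rel U), T = .eqty A M₀ M₁ ∧ τ.mem (𝟙 U) (A, 𝒜) ∧
    𝒜.mem (𝟙 U) (M₀, M₀) ∧ 𝒜.mem (𝟙 U) (M₁, M₁) ∧ X = valClo (eqRel 𝒜 M₀ M₁)

def CloLtr : Prop :=
  ∃ (κ : Fin U.card) (A : Tm U 0) (𝒜 : Rel U), T = .later κ A ∧
    (Later U κ fun ρ => τ.mem ρ (A.res ρ, 𝒜.res ρ)) ∧ X = laterRel κ 𝒜

def CloIsect : Prop :=
  ∃ (A : Exp clkObj (tmObj 0) U) (𝒜 : Exp clkObj relObj U), T = .isect A ∧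
    (∀ (V : World) (ρ : V ⟶ U) (κ : Fin V.card), τ.mem ρ (A.app ρ κ, 𝒜.app ρ κ)) ∧
    X = isectRel 𝒜

def CloKFun : Prop :=
  ∃ (A : Exp clkObj (tmObj 0) U) (𝒜 : Exp clkObj relObj U), T = .kprod A ∧
    (∀ (V : World) (ρ : V ⟶ U) (κ : Fin V.card), τ.mem ρ (A.app ρ κ, 𝒜.app ρ κ)) ∧
    X = kprodRel 𝒜

/-- The union of the clauses for all connectives other than universes. -/
def Conn : Prop :=
  CloVoid T X ∨ CloUnit T X ∨ CloBool T X ∨ CloNat T X ∨ CloProd τ T X ∨ CloFun τ T X ∨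
    CloKFun τ T X ∨ CloEq τ T X ∨ CloLtr τ T X ∨ CloIsect τ T X ∨ CloW τ T X

theorem cts_closed (τ : CTS U) (ρ : V ⟶ U) (σ : W ⟶ V) {A : Tm V 0} {X : Rel V}
    (h : τ.mem ρ (A, X)) : τ.mem (σ ≫ ρ) (A.res σ, X.res σ) := τ.closed ρ σ _ h

theorem lfp_res {Y : ClkTopos} (Φ : ∀ {V : World}, (V ⟶ U) → Pow Y V → Pow Y V) (ρ : V ⟶ U) :
    (Pow.lfp Φ).res ρ = Pow.lfp fun {W} (σ : W ⟶ V) => Φ (σ ≫ ρ) := by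
  ext W σ x
  simp only [Pow.res_mem, Pow.lfp, Category.assoc]

theorem wRel_res (A : Rel U) (B : Exp (tmObj 0) relObj U) (ρ : V ⟶ U) :
    (wRel A B).res ρ = wRel (A.res ρ) (B.res ρ) := by
  rw [wRel, lfp_res, wRel]
  rfl

variable {τ T X}

theorem Family.res {𝒜 : Rel U} {B : Tm U 1} {ℬ : Exp (tmObj 0) relObj U}
    (h : Family τ 𝒜 B ℬ) (ρ : V ⟶ U) : Family (τ.res ρ) (𝒜.res ρ) (B.res ρ) (ℬ.res ρ) := by
  intro W σ M₀ M₁ hM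
  simpa [Exp.res] using h W (σ ≫ ρ) M₀ M₁ hM

theorem Conn.res (h : Conn τ T X) (ρ : V ⟶ U) : Conn (τ.res ρ) (T.res ρ) (X.res ρ) := by
  have hid : ∀ {A : Tm U 0} {Y : Rel U}, τ.mem (𝟙 U) (A, Y) →
      (τ.res ρ).mem (𝟙 V) (A.res ρ, Y.res ρ) := fun h => by
    simpa using cts_closed τ (𝟙 U) ρ h
  have hrel : ∀ (Y : Rel U) {M N : Tm U 0}, Y.mem (𝟙 U) (M, N) →
      (Y.res ρ).mem (𝟙 V) (M.res ρ, N.res ρ) := fun Y _ _ h => by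
    simpa using rel_closed Y (𝟙 U) ρ h
  rcases h with h | h | h | h | h | h | h | h | h | h | h
  · obtain ⟨rfl, rfl⟩ := h
    exact .inl ⟨rfl, rfl⟩
  · obtain ⟨rfl, rfl⟩ := h
    exact .inr <| .inl ⟨rfl, rfl⟩
  · obtain ⟨rfl, rfl⟩ := h
    exact .inr <| .inr <| .inl ⟨rfl, rfl⟩
  · obtain ⟨rfl, rfl⟩ := h
    refine .inr <| .inr <| .inr <| .inl ⟨rfl, ?_⟩
    rw [valClo_res, natRel, lfp_res]
    rfl
  · obtain ⟨A, B, 𝒜, ℬ, rfl, hA, hB, rfl⟩ := h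
    refine .inr <| .inr <| .inr <| .inr <| .inl
      ⟨A.res ρ, B.res ρ, 𝒜.res ρ, ℬ.res ρ, rfl, hid hA, hB.res ρ, ?_⟩
    ext W σ x
    simp [sgRel, relOf, Exp.res]
  · obtain ⟨A, B, 𝒜, ℬ, rfl, hA, hB, rfl⟩ := h
    refine .inr <| .inr <| .inr <| .inr <| .inr <| .inl
      ⟨A.res ρ, B.res ρ, 𝒜.res ρ, ℬ.res ρ, rfl, hid hA, hB.res ρ, ?_⟩
    ext W σ x
    simp [piRel, relOf, Exp.res]
  · obtain ⟨A, 𝒜, rfl, hA, rfl⟩ := h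
    refine .inr <| .inr <| .inr <| .inr <| .inr <| .inr <| .inl
      ⟨A.res ρ, 𝒜.res ρ, rfl, fun W σ κ => hA W (σ ≫ ρ) κ, ?_⟩
    ext W σ x
    simp [kprodRel, relOf, Exp.res]
  · obtain ⟨A, M₀, M₁, 𝒜, rfl, hA, h₀, h₁, rfl⟩ := h
    refine .inr <| .inr <| .inr <| .inr <| .inr <| .inr <| .inr <| .inl
      ⟨A.res ρ, M₀.res ρ, M₁.res ρ, 𝒜.res ρ, rfl, hid hA, hrel _ h₀, hrel _ h₁, ?_⟩
    rw [valClo_res]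
    congr 1
    ext W σ x
    simp [eqRel, relOf]
  · obtain ⟨κ, A, 𝒜, rfl, hA, rfl⟩ := h
    refine .inr <| .inr <| .inr <| .inr <| .inr <| .inr <| .inr <| .inr <| .inl
      ⟨act ρ κ, A.res ρ, 𝒜.res ρ, rfl, ?_, ?_⟩
    · have := hA.mono (fun {V' W'} ρ' σ' h' => by simpa using cts_closed τ ρ' σ' h') ρ
      simpa using this
    · ext W σ x
      simp [laterRel, relOf]
  · obtain ⟨A, 𝒜, rfl, hA, rfl⟩ := h
    refine .inr <| .inr <| .inr <| .inr <| .inr <| .inr <| .inr <| .inr <| .inr <| .inl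
      ⟨A.res ρ, 𝒜.res ρ, rfl, fun W σ κ => hA W (σ ≫ ρ) κ, ?_⟩
    ext W σ x
    simp [isectRel, relOf, Exp.res]
  · obtain ⟨A, B, 𝒜, ℬ, rfl, hA, hB, rfl⟩ := h
    refine .inr <| .inr <| .inr <| .inr <| .inr <| .inr <| .inr <| .inr <| .inr <| .inr
      ⟨A.res ρ, B.res ρ, 𝒜.res ρ, ℬ.res ρ, rfl, hid hA, hB.res ρ, ?_⟩
    rw [valClo_res, wRel_res]

/-- The candidate type system of all types obtained from `τ` by one connective. -/
def conns (τ : CTS U) : CTS U :=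
  ctsOf (fun ρ T X => Conn (τ.res ρ) T X) (by
    intro V W ρ σ A X h
    simpa using h.res σ)

/-- The monotone operator whose least fixed point closes `σ` under the connectives. -/
def tsFun (σ τ : CTS U) : CTS U :=
  ctsOf (fun ρ T X => σ.mem ρ (T, X) ∨ (ctsValClo (conns τ)).mem ρ (T, X)) (by
    rintro V W ρ ρ' A X (h | h)
    exacts [.inl (cts_closed σ ρ ρ' h), .inr (cts_closed _ ρ ρ' h)])

/-- The closure of a candidate type system under all connectives other than universes. -/
def tsClose (σ : CTS U) : CTS U := Pow.lfp fun ρ τ => tsFun (σ.res ρ) τ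

/-! ## Similarity of types and elements, sequents, and context validity -/

def SimType (τ : CTS U) (A B : Tm U 0) : Prop :=
  ∃ 𝒜 : Rel U, τ.mem (𝟙 U) (A, 𝒜) ∧ τ.mem (𝟙 U) (B, 𝒜)

def SimMem (τ : CTS U) (M₀ M₁ A : Tm U 0) : Prop :=
  ∃ 𝒜 : Rel U, τ.mem (𝟙 U) (A, 𝒜) ∧ 𝒜.mem (𝟙 U) (M₀, M₁)

theorem SimType.res {τ : CTS U} {A B : Tm U 0} (h : SimType τ A B) (ρ : V ⟶ U) :
    SimType (τ.res ρ) (A.res ρ) (B.res ρ) := by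
  obtain ⟨𝒜, h₀, h₁⟩ := h
  refine ⟨𝒜.res ρ, ?_, ?_⟩
  · simpa using cts_closed τ (𝟙 U) ρ h₀
  · simpa using cts_closed τ (𝟙 U) ρ h₁

/-- Telescopes of length `n` at world `U`. -/
inductive Tl (U : World) : ℕ → Type
  | nil : Tl U 0
  | snoc {n : ℕ} (Γ : Tl U n) (A : Tm U n) : Tl U (n + 1)

def Tl.res {n : ℕ} : Tl U n → (V ⟶ U) → Tl V n
  | nil, _ => nil
  | snoc Γ A, ρ => snoc (Γ.res ρ) (A.res ρ)

/-- Similarity of instantiations of a telescope. -/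
def SimEnv (τ : CTS U) : {n : ℕ} → Tl U n → (Fin n → Tm U 0) → (Fin n → Tm U 0) → Prop
  | _, .nil, _, _ => True
  | _, .snoc Γ A, γ₀, γ₁ => SimEnv τ Γ (Fin.tail γ₀) (Fin.tail γ₁) ∧
      SimMem τ (γ₀ 0) (γ₁ 0) (A.subst (Fin.tail γ₀))

/-- Open type similarity, forced at world `U`. -/
def HypSimType (τ : CTS U) {n : ℕ} (Γ : Tl U n) (A₀ A₁ : Tm U n) : Prop :=
  ∀ (V : World) (ρ : V ⟶ U) (γ₀ γ₁ : Fin n → Tm V 0), SimEnv (τ.res ρ) (Γ.res ρ) γ₀ γ₁ →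
    SimType (τ.res ρ) ((A₀.res ρ).subst γ₀) ((A₁.res ρ).subst γ₁)

/-- Open member similarity, forced at world `U`. -/
def HypSimMem (τ : CTS U) {n : ℕ} (Γ : Tl U n) (M₀ M₁ A : Tm U n) : Prop :=
  ∀ (V : World) (ρ : V ⟶ U) (γ₀ γ₁ : Fin n → Tm V 0), SimEnv (τ.res ρ) (Γ.res ρ) γ₀ γ₁ →
    SimMem (τ.res ρ) ((M₀.res ρ).subst γ₀) ((M₁.res ρ).subst γ₁) ((A.res ρ).subst γ₀)

/-- Context validity, forced at world `U`. -/
def IsCtx (τ : CTS U) : {n : ℕ} → Tl U n → Prop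
  | _, .nil => True
  | _, .snoc Γ A => IsCtx τ Γ ∧ HypSimType τ Γ A A

/-! ## The universe hierarchy -/

/-- The relation of being similar types of `τ`. -/
def univRel (τ : CTS U) : Rel U :=
  relOf (fun ρ A₀ A₁ => SimType (τ.res ρ) A₀ A₁) (by
    intro V W ρ σ A₀ A₁ h
    simpa using h.res σ)

/-- The universes `univ i` for `i ≤ n`, where `univ i` is the universe of types of `τ i`. -/
def univSystem (n : ℕ) (τ : ∀ i, i ≤ n → CTS U) : CTS U :=
  ctsOf (fun ρ T X => ∃ (i : ℕ) (h : i ≤ n), T = .univ i ∧ X = (univRel (τ i h)).res ρ) (by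
    rintro V W ρ σ _ _ ⟨i, h, rfl, rfl⟩
    exact ⟨i, h, rfl, by simp⟩)

/-- The empty candidate type system. -/
def ctsBot (U : World) : CTS U := ctsOf (fun _ _ _ => False) (by intros; assumption)

end Relations

/-- The spine of the universe hierarchy. -/
def spine : ℕ → (U : World) → CTS U
  | 0, U => ctsBot U
  | n + 1, U => ctsValClo (univSystem n fun i _ => tsClose (spine i U))
termination_by n => n
decreasing_by omega

/-- The type systems `τ_n`. -/
def tower (n : ℕ) (U : World) : CTS U := tsClose (spine n U)

/-- The join `τ_ω` of all the type systems `τ_n`. -/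
def towerOmega (U : World) : CTS U :=
  ctsOf (fun ρ A X => ∃ n, (tower n U).mem ρ (A, X)) (by
    rintro V W ρ σ A X ⟨n, h⟩
    exact ⟨n, cts_closed _ ρ σ h⟩)

/-! ## Formal terms and their elaboration -/

/-- Formal terms with `d` free (de Bruijn) clock variables and `n` free variables, up to renaming
of bound variables. The most recently bound variable has index `0`. -/
inductive FTm : ℕ → ℕ → Type
  | var {d n : ℕ} (i : Fin n) : FTm d n
  | lam {d n : ℕ} (M : FTm d (n + 1)) : FTm d n
  | klam {d n : ℕ} (M : FTm (d + 1) n) : FTm d n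
  | app {d n : ℕ} (M N : FTm d n) : FTm d n
  | kapp {d n : ℕ} (M : FTm d n) (k : Fin d) : FTm d n
  | pair {d n : ℕ} (M N : FTm d n) : FTm d n
  | fst {d n : ℕ} (M : FTm d n) : FTm d n
  | snd {d n : ℕ} (M : FTm d n) : FTm d n
  | fix {d n : ℕ} (M : FTm d (n + 1)) : FTm d n
  | star {d n : ℕ} : FTm d n
  | tt {d n : ℕ} : FTm d n
  | ff {d n : ℕ} : FTm d n
  | ifb {d n : ℕ} (Mb Mt Mf : FTm d n) : FTm d n
  | ze {d n : ℕ} : FTm d n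
  | su {d n : ℕ} (M : FTm d n) : FTm d n
  | ifze {d n : ℕ} (Mn Mz : FTm d n) (Ms : FTm d (n + 1)) : FTm d n
  | sup {d n : ℕ} (M : FTm d n) (N : FTm d (n + 1)) : FTm d n
  | wrec {d n : ℕ} (M : FTm d n) (N : FTm d (n + 3)) : FTm d n
  | pi {d n : ℕ} (A : FTm d n) (B : FTm d (n + 1)) : FTm d n
  | sg {d n : ℕ} (A : FTm d n) (B : FTm d (n + 1)) : FTm d n
  | wty {d n : ℕ} (A : FTm d n) (B : FTm d (n + 1)) : FTm d n
  | eqty {d n : ℕ} (A M N : FTm d n) : FTm d n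
  | kprod {d n : ℕ} (A : FTm (d + 1) n) : FTm d n
  | isect {d n : ℕ} (A : FTm (d + 1) n) : FTm d n
  | later {d n : ℕ} (k : Fin d) (A : FTm d n) : FTm d n
  | void {d n : ℕ} : FTm d n
  | unit {d n : ℕ} : FTm d n
  | bool {d n : ℕ} : FTm d n
  | nat {d n : ℕ} : FTm d n
  | univ {d n : ℕ} (i : ℕ) : FTm d n

namespace FTm

/-- Extension of a clock environment `ϱ` at `U` to `(ρ^* ϱ, κ)` at a world `V` over `U`. -/
def extend {U V : World} {d : ℕ} (ϱ : Fin d → Fin U.card) (ρ : V ⟶ U) (κ : Fin V.card) :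
    Fin (d + 1) → Fin V.card := Fin.cases κ fun i => act ρ (ϱ i)

/-- The raw tree of the elaboration of a formal term in a clock environment. -/
def interpRaw : {d n : ℕ} → FTm d n → {U : World} → (Fin d → Fin U.card) → Raw U n
  | _, _, var i, _, _ => .var i
  | _, _, lam M, _, ϱ => .lam (M.interpRaw ϱ)
  | _, _, klam M, _, ϱ => .klam fun _ ρ κ => M.interpRaw (extend ϱ ρ κ)
  | _, _, app M N, _, ϱ => .app (M.interpRaw ϱ) (N.interpRaw ϱ)
  | _, _, kapp M k, _, ϱ => .kapp (M.interpRaw ϱ) (ϱ k)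
  | _, _, pair M N, _, ϱ => .pair (M.interpRaw ϱ) (N.interpRaw ϱ)
  | _, _, fst M, _, ϱ => .fst (M.interpRaw ϱ)
  | _, _, snd M, _, ϱ => .snd (M.interpRaw ϱ)
  | _, _, fix M, _, ϱ => .fix (M.interpRaw ϱ)
  | _, _, star, _, _ => .star
  | _, _, tt, _, _ => .tt
  | _, _, ff, _, _ => .ff
  | _, _, ifb Mb Mt Mf, _, ϱ => .ifb (Mb.interpRaw ϱ) (Mt.interpRaw ϱ) (Mf.interpRaw ϱ)
  | _, _, ze, _, _ => .ze
  | _, _, su M, _, ϱ => .su (M.interpRaw ϱ)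
  | _, _, ifze Mn Mz Ms, _, ϱ => .ifze (Mn.interpRaw ϱ) (Mz.interpRaw ϱ) (Ms.interpRaw ϱ)
  | _, _, sup M N, _, ϱ => .sup (M.interpRaw ϱ) (N.interpRaw ϱ)
  | _, _, wrec M N, _, ϱ => .wrec (M.interpRaw ϱ) (N.interpRaw ϱ)
  | _, _, pi A B, _, ϱ => .pi (A.interpRaw ϱ) (B.interpRaw ϱ)
  | _, _, sg A B, _, ϱ => .sg (A.interpRaw ϱ) (B.interpRaw ϱ)
  | _, _, wty A B, _, ϱ => .wty (A.interpRaw ϱ) (B.interpRaw ϱ)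
  | _, _, eqty A M N, _, ϱ => .eqty (A.interpRaw ϱ) (M.interpRaw ϱ) (N.interpRaw ϱ)
  | _, _, kprod A, _, ϱ => .kprod fun _ ρ κ => A.interpRaw (extend ϱ ρ κ)
  | _, _, isect A, _, ϱ => .isect fun _ ρ κ => A.interpRaw (extend ϱ ρ κ)
  | _, _, later k A, _, ϱ => .later (ϱ k) (A.interpRaw ϱ)
  | _, _, void, _, _ => .void
  | _, _, unit, _, _ => .unit
  | _, _, bool, _, _ => .bool
  | _, _, nat, _, _ => .nat
  | _, _, univ i, _, _ => .univ i

theorem act_extend {U V W : World} {d : ℕ} (ϱ : Fin d → Fin U.card) (ρ : V ⟶ U) (κ : Fin V.card)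
    (σ : W ⟶ V) : (fun i => act σ (extend ϱ ρ κ i)) = extend ϱ (σ ≫ ρ) (act σ κ) := by
  funext i
  refine Fin.cases ?_ (fun i => ?_) i <;> simp [extend]

theorem extend_act {U V W : World} {d : ℕ} (ϱ : Fin d → Fin U.card) (ρ : V ⟶ U) (σ : W ⟶ V)
    (κ : Fin W.card) : extend (fun i => act ρ (ϱ i)) σ κ = extend ϱ (σ ≫ ρ) κ := rfl

theorem interpRaw_res {d n : ℕ} (M : FTm d n) {U V : World} (ϱ : Fin d → Fin U.card)
    (ρ : V ⟶ U) : (M.interpRaw ϱ).res ρ = M.interpRaw fun i => act ρ (ϱ i) := by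
  induction M generalizing U V <;> simp only [interpRaw, Raw.res, extend_act, *]

theorem interpRaw_natural {d n : ℕ} (M : FTm d n) {U : World} (ϱ : Fin d → Fin U.card) :
    (M.interpRaw ϱ).Natural := by
  induction M generalizing U <;>
    simp only [interpRaw, Raw.Natural, interpRaw_res, act_extend, implies_true, and_self, *]

/-- Elaboration of formal terms into programs: the component at `U` of the morphism
`Clk ^ d ⟶ Tm n` denoted by a formal term. -/
def interp {d n : ℕ} (M : FTm d n) {U : World} (ϱ : Fin d → Fin U.card) : Tm U n :=
  ⟨M.interpRaw ϱ, M.interpRaw_natural ϱ⟩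

end FTm

/-- Formal typing contexts over `d` clock variables, of length `n`. -/
inductive FCtx (d : ℕ) : ℕ → Type
  | nil : FCtx d 0
  | snoc {n : ℕ} (Γ : FCtx d n) (A : FTm d n) : FCtx d (n + 1)

/-- Elaboration of formal contexts into telescopes. -/
def FCtx.interp {d : ℕ} : {n : ℕ} → FCtx d n → {U : World} → (Fin d → Fin U.card) → Tl U n
  | _, nil, _, _ => .nil
  | _, snoc Γ A, _, ϱ => .snoc (Γ.interp ϱ) (A.interp ϱ)

/-! ## Meaning explanation -/

/-- `U ⊩ ⟦ Δ | Γ ⊢ M₀ = M₁ ∈ A ⟧`: for every clock environment, if the context is valid and the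
type is functional then `M₀` and `M₁` are equal elements. The successive worlds are those of the
forcing clauses for the universal quantifier and the two implications. -/
def EqMem {d n : ℕ} (Γ : FCtx d n) (M₀ M₁ A : FTm d n) (U : World) : Prop :=
  ∀ (V : World) (_ : V ⟶ U) (ϱ : Fin d → Fin V.card),
    ∀ (V₁ : World) (ρ₁ : V₁ ⟶ V),
      IsCtx (towerOmega V₁) (Γ.interp fun i => act ρ₁ (ϱ i)) →
    ∀ (V₂ : World) (ρ₂ : V₂ ⟶ V₁),
      HypSimType (towerOmega V₂) (Γ.interp fun i => act (ρ₂ ≫ ρ₁) (ϱ i))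
        (A.interp fun i => act (ρ₂ ≫ ρ₁) (ϱ i)) (A.interp fun i => act (ρ₂ ≫ ρ₁) (ϱ i)) →
      HypSimMem (towerOmega V₂) (Γ.interp fun i => act (ρ₂ ≫ ρ₁) (ϱ i))
        (M₀.interp fun i => act (ρ₂ ≫ ρ₁) (ϱ i)) (M₁.interp fun i => act (ρ₂ ≫ ρ₁) (ϱ i))
        (A.interp fun i => act (ρ₂ ≫ ρ₁) (ϱ i))

/-- `U ⊩ ⟦ Δ | Ψ ⊢ M₀ ≃ M₁ ⟧`: `M₀` and `M₁` are Kleene equivalent in all their instantiations. -/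
def OpenConv {d n : ℕ} (M₀ M₁ : FTm d n) (U : World) : Prop :=
  ∀ (V : World) (_ : V ⟶ U) (ϱ : Fin d → Fin V.card), Tm.OpenSq (M₀.interp ϱ) (M₁.interp ϱ)

/-- The embedding of booleans into closed formal terms. -/
def embed : Bool → FTm 0 0
  | true => .tt
  | false => .ff

end GCTT

/-!
Canonicity reads off the clause for `bool` in the tower of type systems.

The type system `τ_ω` assigns to `bool` only the relation "both sides evaluate to `tt`, or both to
`ff`". Indeed the candidate type system `boolDetermined`, of those `(A, 𝒜)` such that `A` has a
canonical form, and `𝒜` is this relation if the canonical form is `bool`, is a prefixed point of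
the operator defining each `τ_n`: no other clause concerns a program with canonical form `bool`,
and canonical forms are unique because the transition relation is deterministic
(`Raw.Step.deterministic`). So `tower_le_boolDetermined` follows by induction on the least fixed
point. As `bool` is a type of `τ_ω` at every world, the judgment `M = M ∈ bool` at `U` gives a
boolean to which `M` evaluates at `U`. Evaluation is stable under restriction and deterministic,
so `M` is Kleene equivalent to that boolean at every world over `U`.

For the last assertion, any two worlds map to a common one: the world with a single clock on which
enough time is left. Kleene equivalence restricts along both morphisms, and a program cannot
evaluate both to `tt` and to `ff`, so the boolean does not depend on the world.
-/

namespace GCTT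

open CategoryTheory

/-! ### Determinism of evaluation -/

theorem Raw.Val.not_step {U : World} {M N : Raw U 0} (h : M.Val) : ¬ M.Step N := by
  intro s
  cases h <;> cases s

theorem Raw.Step.deterministic {U : World} {M N N' : Raw U 0} (h : M.Step N) (h' : M.Step N') :
    N = N' := by
  induction h generalizing N' <;> cases h'
  -- Twice the same principal reduction, or two congruence steps.
  any_goals rfl
  any_goals rename_i ih _ s; rw [ih s]
  -- A congruence step against a principal reduction: the principal argument is a value.
  all_goals
    first
    | (rename_i s _; exact absurd s (Raw.Val.not_step (by constructor)))
    | (rename_i s; exact absurd s (Raw.Val.not_step (by constructor)))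

namespace Tm
variable {U V : World}

theorem Steps.eq_of_val {M N : Tm U 0} (h : Steps M N) (hM : M.Val) : N = M := by
  rcases Relation.ReflTransGen.cases_head h with h | ⟨P, s, -⟩
  · exact h.symm
  · exact absurd s (Raw.Val.not_step hM)

theorem Eval.unique {M N N' : Tm U 0} (h : Eval M N) (h' : Eval M N') : N = N' := by
  have hdet : Relator.RightUnique (Step (U := U)) :=
    fun _ _ _ s s' => Subtype.ext (Raw.Step.deterministic s s')
  rcases Relation.ReflTransGen.total_of_right_unique hdet h.1 h'.1 with s | s
  · exact (Steps.eq_of_val s h.2).symm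
  · exact Steps.eq_of_val s h'.2

theorem Val.eval {M : Tm U 0} (h : M.Val) : M.Eval M := ⟨.refl, h⟩

theorem res_eq_bool {M : Tm U 0} {ρ : V ⟶ U} (h : M.res ρ = .bool) : M = .bool := by
  obtain ⟨M, hM⟩ := M
  have h' : M.res ρ = .bool := congrArg Subtype.val h
  apply Subtype.ext
  cases M <;> first | rfl | (simp only [Raw.res] at h'; cases h')

theorem Eval.closedSq {M N : Tm U 0} (h : Eval M N) : ClosedSq M N := by
  constructor
  · intro V ρ P hP s
    rw [Eval.unique ⟨s, hP⟩ (h.res ρ)]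
    exact .refl
  · intro V ρ P _ s
    rw [Steps.eq_of_val s (h.res ρ).2]
    exact (h.res ρ).1

end Tm

/-! ### The relation assigned to the type of booleans -/

section
variable {U V : World}

/-- The candidate type system of all `(A, X)` such that `A` has a canonical form, and `X` is the
relation of evaluating to the same boolean in case that form is `bool`. -/
def boolDetermined (U : World) : CTS U :=
  ctsOf (fun {V} _ A X => ∃ A', A.Eval A' ∧ (A' = .bool → X = valClo (boolRel V))) (by
    rintro V W _ σ A X ⟨A', hA, hX⟩
    refine ⟨A'.res σ, hA.res σ, fun h => ?_⟩
    rw [hX (Tm.res_eq_bool h), valClo_res]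
    rfl)

theorem conn_bool {τ : CTS U} {X : Rel U} (h : Conn τ .bool X) : X = valClo (boolRel U) := by
  rcases h with h | h | h | h | h | h | h | h | h | h | h
  case inr.inr.inl => exact h.2
  case inl | inr.inl | inr.inr.inr.inl => exact nomatch congrArg Subtype.val h.1
  all_goals
    first
    | (obtain ⟨_, _, _, _, e, _⟩ := h; exact nomatch congrArg Subtype.val e)
    | (obtain ⟨_, _, _, e, _⟩ := h; exact nomatch congrArg Subtype.val e)
    | (obtain ⟨_, _, e, _⟩ := h; exact nomatch congrArg Subtype.val e)

theorem spine_le_boolDetermined (n : ℕ) {ρ : V ⟶ U} {A : Tm V 0} {X : Rel V}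
    (h : (spine n U).mem ρ (A, X)) : ∃ A', A.Eval A' ∧ (A' = .bool → X = valClo (boolRel V)) := by
  cases n with
  | zero =>
    rw [spine] at h
    exact h.elim
  | succ n =>
    rw [spine] at h
    obtain ⟨A', hA, i, _, rfl, _⟩ := h
    exact ⟨_, hA, fun e => nomatch congrArg Subtype.val e⟩

/-- Every type of `τ_n` lies in `boolDetermined`, because that is a prefixed point of the operator
whose least fixed point is `τ_n`. -/
theorem tower_le_boolDetermined (n : ℕ) {A : Tm U 0} {X : Rel U}
    (h : (tower n U).mem (𝟙 U) (A, X)) :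
    ∃ A', A.Eval A' ∧ (A' = .bool → X = valClo (boolRel U)) := by
  have hpre : Pow.Sub (tsFun ((spine n U).res (𝟙 U ≫ 𝟙 U)) (boolDetermined U))
      (boolDetermined U) := by
    rintro V ρ ⟨A, X⟩ (h | ⟨A', hA, h⟩)
    · exact spine_le_boolDetermined n h
    · exact ⟨A', hA, by rintro rfl; exact conn_bool h⟩
  have := h U (𝟙 U) (boolDetermined U) hpre
  simpa [boolDetermined, ctsOf] using this

theorem towerOmega_bool (U : World) :
    (towerOmega U).mem (𝟙 U) (.bool, valClo (boolRel U)) := by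
  refine ⟨0, fun W σ S hS => ?_⟩
  exact hS W (𝟙 W) _ (.inr ⟨.bool, Tm.Val.eval .bool, .inr (.inr (.inl ⟨rfl, rfl⟩))⟩)

theorem simType_bool (U : World) : SimType (towerOmega U) .bool .bool :=
  ⟨_, towerOmega_bool U, towerOmega_bool U⟩

theorem SimMem.eval_bool {M : Tm U 0} (h : SimMem (towerOmega U) M M .bool) :
    M.Eval .tt ∨ M.Eval .ff := by
  obtain ⟨X, ⟨n, hX⟩, hM⟩ := h
  obtain ⟨A', hA, e⟩ := tower_le_boolDetermined n hX
  obtain rfl := e (hA.unique (Tm.Val.eval .bool))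
  obtain ⟨N, _, hN, _, ⟨rfl, _⟩ | ⟨rfl, _⟩⟩ := hM
  exacts [.inl hN, .inr hN]

end

/-! ### Canonicity -/

/-- The elaboration of a closed formal term at world `U`, as a closed program. The empty
substitution that forms closing instances in the judgments is built in. -/
def FTm.program (M : FTm 0 0) (U : World) : Tm U 0 :=
  (M.interp (U := U) Fin.elim0).subst Fin.elim0

theorem FTm.program_eq (M : FTm 0 0) {U V : World} (ρ : V ⟶ U) (ϱ : Fin 0 → Fin U.card)
    (γ : Fin 0 → Tm V 0) : ((M.interp ϱ).res ρ).subst γ = M.program V := by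
  have e : (M.interp ϱ).res ρ = M.interp (U := V) Fin.elim0 := by
    apply Subtype.ext
    exact (M.interpRaw_res ϱ ρ).trans (congrArg _ (Subsingleton.elim _ _))
  rw [e, Subsingleton.elim γ Fin.elim0, FTm.program]

theorem FTm.program_res (M : FTm 0 0) {U V : World} (ρ : V ⟶ U) :
    (M.program U).res ρ = M.program V := by
  rw [FTm.program, Tm.res_subst, FTm.program_eq]

theorem openConv_of_eval {M N : FTm 0 0} {U : World}
    (h : (M.program U).Eval (N.program U)) : OpenConv M N U := by
  intro V ρ ϱ W σ γ
  rw [FTm.program_eq, FTm.program_eq, ← M.program_res (σ ≫ ρ), ← N.program_res (σ ≫ ρ)]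
  exact (h.res _).closedSq

theorem eval_embed_of_eqMem {M : FTm 0 0} {U : World} (h : EqMem .nil M M .bool U) :
    ∃ b : Bool, (M.program U).Eval ((embed b).program U) := by
  have hM := h U (𝟙 U) Fin.elim0 U (𝟙 U) trivial U (𝟙 U)
    (fun V ρ _ _ _ => (simType_bool U).res ρ) U (𝟙 U) Fin.elim0 Fin.elim0 trivial
  rw [FTm.program_eq, Pow.res_id] at hM
  rcases SimMem.eval_bool hM with h | h
  exacts [⟨true, h⟩, ⟨false, h⟩]

theorem embed_program_injective {b c : Bool} {U : World}
    (h : (embed b).program U = (embed c).program U) : b = c := by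
  cases b <;> cases c <;> first | rfl | exact nomatch congrArg Subtype.val h

/-- The world with one clock, on which `t` units of time are left. -/
def World.single (t : ℕ) : World := ⟨1, Nat.one_pos, fun _ => t⟩

theorem World.nonempty_hom_single {U : World} {t : ℕ} {κ : Fin U.card} (h : U.time κ ≤ t) :
    Nonempty (U ⟶ World.single t) :=
  ⟨World.Hom.mk (fun _ => κ) fun _ => h⟩

end GCTT

theorem mainTheorem1 (M : GCTT.FTm 0 0) :
    (∀ U : GCTT.World, GCTT.EqMem .nil M M .bool U →
      ∃ b : Bool, GCTT.OpenConv M (GCTT.embed b) U) ∧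
    ((∀ U : GCTT.World, GCTT.EqMem .nil M M .bool U) →
      ∃ b : Bool, ∀ U : GCTT.World, GCTT.OpenConv M (GCTT.embed b) U) := by
  refine ⟨fun U h => ?_, fun h => ?_⟩
  · obtain ⟨b, hb⟩ := GCTT.eval_embed_of_eqMem h
    exact ⟨b, GCTT.openConv_of_eval hb⟩
  · obtain ⟨b, hb⟩ := GCTT.eval_embed_of_eqMem (h (GCTT.World.single 0))
    refine ⟨b, fun U => GCTT.openConv_of_eval ?_⟩
    -- Both `U` and the reference world `single 0` map to the world `single t`.
    let t := U.time ⟨0, U.card_pos⟩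
    obtain ⟨c, hc⟩ := GCTT.eval_embed_of_eqMem (h (GCTT.World.single t))
    obtain ⟨ρ⟩ := GCTT.World.nonempty_hom_single (U := U) (t := t) le_rfl
    obtain ⟨σ⟩ := GCTT.World.nonempty_hom_single (U := GCTT.World.single 0) (t := t)
      (κ := (0 : Fin 1)) (Nat.zero_le t)
    have hσ := hc.res σ
    rw [GCTT.FTm.program_res, GCTT.FTm.program_res] at hσ
    obtain rfl := GCTT.embed_program_injective (hb.unique hσ)
    simpa only [GCTT.FTm.program_res] using hc.res ρ
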